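/- Let $1\le p<\infty$, let $\Omega$ be a compact metrizable space (for instance a compact subset of $\mathbb R^d$) with a Borel probability measure $\mu$, and let $W\subset C(\Omega)$ be a set of real- or complex-valued continuous functions such that $0\in W$ and $\|f\|_\infty\le M$ for all $f\in W$, where $\|f\|_\infty=\max_{x\in\Omega}|f(x)|$. Write $\|f\|_p^p=\int_\Omega|f|^p\,d\mu$. For $N\ge1$ let $\rho_N(W)$ be the infimum of all $\varepsilon>0$ such that $W$ is covered by $N$ closed $\|\cdot\|_\infty$-balls of radius $\varepsilon$ with (not necessarily distinct) centres in $W$, and put $$\varepsilon_n(W,L_\infty)=\rho_{2^n}(W)\ (n\ge0),\qquad e_0(W,L_\infty)=\rho_1(W),\qquad e_k(W,L_\infty)=\rho_{2^{2^k}}(W)\ (k\ge1).$$ For $m\ge1$ let $$er_m(W,L_p)=\inf_{\xi^1,\dots,\xi^m\in\Omega}\ \sup_{f\in W}\Bigl|\|f\|_p^p-\frac1m\sum_{j=1}^m|f(\xi^j)|^p\Bigr| .$$ Let $X_1,\dots,X_m$ be independent random elements of $\Omega$ with distribution $\mu$. Then, with an absolute constant $C>0$ (independent of $p,M,m,\Omega,\mu,W$),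 the random variable $\sup_{f\in W}\bigl|\frac1m\sum_{j=1}^m|f(X_j)|^p-\|f\|_p^p\bigr|$ is integrable, and $$er_m(W,L_p)\le \mathbb E\Bigl[\sup_{f\in W}\Bigl|\frac1m\sum_{j=1}^m|f(X_j)|^p-\|f\|_p^p\Bigr|\Bigr]\le C\,p^2M^{\max\{p/2,\,p-1\}}m^{-1/2}\sum_{k=0}^{\lfloor\log_2 m\rfloor}2^{k/2}e_k(W,L_\infty)^{\min\{2,p\}/2}.$$ Equivalently, the same expectation is at most $$C\,p^2M^{\max\{p/2,\,p-1\}}m^{-1/2}\sum_{n=0}^{m}(n+1)^{-1/2}\varepsilon_n(W,L_\infty)^{\min\{2,p\}/2};$$ here each of the two sums (over $k$ and over $n$) is at most $C$ times the other. -/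

import Mathlib

open MeasureTheory ProbabilityTheory

noncomputable section

/-- `coveringRadius W N` is the infimum of the radii `ε > 0` such that `W` is covered by `N` closed
balls of radius `ε` whose centres (repetitions allowed) belong to `W`. -/
def coveringRadius {X : Type*} [PseudoMetricSpace X] (W : Set X) (N : ℕ) : ℝ :=
  sInf {ε : ℝ | 0 < ε ∧ ∃ y : Fin N → X, (∀ j, y j ∈ W) ∧ W ⊆ ⋃ j, Metric.closedBall (y j) ε}

/-- The entropy number `ε_n(W)`: coverings by `2 ^ n` balls. -/
def entropyNumber {X : Type*} [PseudoMetricSpace X] (W : Set X) (n : ℕ) : ℝ :=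
  coveringRadius W (2 ^ n)

/-- The entropy number `e_k(W)`: coverings by `N_k` balls, with `N_0 = 1` and
`N_k = 2 ^ (2 ^ k)` for `k ≥ 1`. -/
def chainEntropyNumber {X : Type*} [PseudoMetricSpace X] (W : Set X) (k : ℕ) : ℝ :=
  coveringRadius W (if k = 0 then 1 else 2 ^ (2 ^ k))

/-- The sum over `0 ≤ k ≤ ⌊log₂ m⌋` of `2 ^ (k / 2) * e_k(W) ^ (min 2 p / 2)`. -/
def chainEntropySum {X : Type*} [PseudoMetricSpace X] (W : Set X) (p : ℝ) (m : ℕ) : ℝ :=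
  ∑ k ∈ Finset.range (Nat.log 2 m + 1),
    (2 : ℝ) ^ ((k : ℝ) / 2) * chainEntropyNumber W k ^ (min 2 p / 2)

/-- The sum over `0 ≤ n ≤ m` of `(n + 1) ^ (-1 / 2) * ε_n(W) ^ (min 2 p / 2)`. -/
def entropySum {X : Type*} [PseudoMetricSpace X] (W : Set X) (p : ℝ) (m : ℕ) : ℝ :=
  ∑ n ∈ Finset.range (m + 1),
    ((n : ℝ) + 1) ^ (-(1 / 2) : ℝ) * entropyNumber W n ^ (min 2 p / 2)

section Sampling

variable {Ω 𝕜 : Type*} [TopologicalSpace Ω] [MeasurableSpace Ω] [RCLike 𝕜]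

/-- The error of the points `ξ`, uniform over the class `W`:
the supremum over `f ∈ W` of `|(1 / m) ∑ |f (ξ j)| ^ p - ‖f‖_p ^ p|`. -/
def samplingError (μ : Measure Ω) (W : Set C(Ω, 𝕜)) (p : ℝ) {m : ℕ} (ξ : Fin m → Ω) : ℝ :=
  ⨆ f : W, |(1 / (m : ℝ)) * ∑ j, ‖(f : C(Ω, 𝕜)) (ξ j)‖ ^ p - ∫ x, ‖(f : C(Ω, 𝕜)) x‖ ^ p ∂μ|

/-- The discretization number `er_m(W, L_p)`: the infimum of the error over all choices of
`m` points. -/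
def discretizationNumber (μ : Measure Ω) (W : Set C(Ω, 𝕜)) (p : ℝ) (m : ℕ) : ℝ :=
  ⨅ ξ : Fin m → Ω, samplingError μ W p ξ

end Sampling

end

/-! The proof is chaining in the sup norm, stopped at level `K = ⌊log₂ m⌋`. On `[0, M]` the map `t ↦
t ^ p` has Lipschitz constant `L = p * M ^ (p - 1)`, so for `f, g ∈ W` the difference `‖f‖ ^ p - ‖g‖
^ p` is bounded by `L * ‖f - g‖`. Hoeffding's lemma then makes the increment of the sampling error
sub-Gaussian with variance proxy `(L * ‖f - g‖) ^ 2 / m` (`hasSubgaussianMGF_powDeviation_sub`); no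
symmetrization is needed.

Join each point of the level `k + 1` net to a near point of the level `k` net. By the maximal
inequality `integral_iSup_abs_le`, the `2 ^ 2 ^ (k + 1)` links cost at most a constant times `L * m
^ (-1 / 2) * 2 ^ (k / 2) * e_k`. The chain starts at `0`, where the error vanishes. The step from
`f` to the net of level `K` is bounded deterministically by Lipschitz continuity, which suffices
because `2 ^ (K / 2)` is comparable to `√m`.

This gives a bound linear in `e_k` with factor `p * M ^ (p - 1)`. Since `e_k ≤ M`, it implies the
stated one (`rpow_mul_chainEntropyNumber_le`). The two entropy sums are compared by dyadic
condensation. -/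

/-! ### Covering radii: near-optimal nets and monotonicity. -/

section CoveringRadius

variable {X : Type*} [PseudoMetricSpace X] {W : Set X}

theorem coveringRadius_nonneg (W : Set X) (N : ℕ) : 0 ≤ coveringRadius W N :=
  Real.sInf_nonneg fun _ h => h.1.le

theorem bddBelow_coveringRadii (W : Set X) (N : ℕ) :
    BddBelow {ε : ℝ | 0 < ε ∧ ∃ y : Fin N → X, (∀ j, y j ∈ W) ∧
      W ⊆ ⋃ j, Metric.closedBall (y j) ε} :=
  ⟨0, fun _ h => h.1.le⟩

theorem mem_coveringRadii {x : X} (hx : x ∈ W) {ε : ℝ} (hε : 0 < ε)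
    (hW : ∀ y ∈ W, dist y x ≤ ε) {N : ℕ} (hN : N ≠ 0) :
    ε ∈ {ε : ℝ | 0 < ε ∧ ∃ y : Fin N → X, (∀ j, y j ∈ W) ∧
      W ⊆ ⋃ j, Metric.closedBall (y j) ε} :=
  ⟨hε, fun _ => x, fun _ => hx, fun y hy =>
    Set.mem_iUnion.2 ⟨⟨0, Nat.pos_of_ne_zero hN⟩, hW y hy⟩⟩

theorem coveringRadius_le {x : X} (hx : x ∈ W) {D : ℝ} (hD : 0 ≤ D)
    (hW : ∀ y ∈ W, dist y x ≤ D) {N : ℕ} (hN : N ≠ 0) : coveringRadius W N ≤ D :=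
  le_of_forall_pos_le_add fun η hη => csInf_le (bddBelow_coveringRadii W N)
    (mem_coveringRadii hx (by positivity) (fun y hy => (hW y hy).trans (by linarith)) hN)

theorem nonempty_coveringRadii {x : X} (hx : x ∈ W) {D : ℝ}
    (hW : ∀ y ∈ W, dist y x ≤ D) {N : ℕ} (hN : N ≠ 0) :
    {ε : ℝ | 0 < ε ∧ ∃ y : Fin N → X, (∀ j, y j ∈ W) ∧
      W ⊆ ⋃ j, Metric.closedBall (y j) ε}.Nonempty :=
  ⟨max D 1, mem_coveringRadii hx (by positivity)
    (fun y hy => (hW y hy).trans (le_max_left _ _)) hN⟩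

/-- Near-optimal nets. -/
theorem exists_net {x : X} (hx : x ∈ W) {D : ℝ} (hW : ∀ y ∈ W, dist y x ≤ D) {N : ℕ}
    (hN : N ≠ 0) {η : ℝ} (hη : 0 < η) :
    ∃ y : Fin N → X, (∀ j, y j ∈ W) ∧ ∀ w ∈ W, ∃ j, dist w (y j) ≤ coveringRadius W N + η := by
  obtain ⟨ε, ⟨_, y, hy, hc⟩, hlt⟩ := Real.lt_sInf_add_pos (nonempty_coveringRadii hx hW hN) hη
  refine ⟨y, hy, fun w hw => ?_⟩
  obtain ⟨j, hj⟩ := Set.mem_iUnion.1 (hc hw)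
  exact ⟨j, (Metric.mem_closedBall.1 hj).trans hlt.le⟩

/-- Centres may repeat, so a smaller net is padded with copies of `x`. -/
theorem coveringRadius_anti {x : X} (hx : x ∈ W) {D : ℝ} (hW : ∀ y ∈ W, dist y x ≤ D) {N N' : ℕ}
    (hN : N ≠ 0) (h : N ≤ N') : coveringRadius W N' ≤ coveringRadius W N := by
  refine csInf_le_csInf (bddBelow_coveringRadii W N') (nonempty_coveringRadii hx hW hN) ?_
  rintro ε ⟨hε, y, hy, hc⟩
  refine ⟨hε, fun j => if hj : (j : ℕ) < N then y ⟨j, hj⟩ else x, fun j => ?_, fun w hw => ?_⟩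
  · dsimp only
    split_ifs with hj
    exacts [hy _, hx]
  · obtain ⟨j, hj⟩ := Set.mem_iUnion.1 (hc hw)
    refine Set.mem_iUnion.2 ⟨⟨j, j.2.trans_le h⟩, ?_⟩
    simpa using hj

/-- Makes both entropy sums run over one antitone sequence. The index is `0` at `k = 0`, since `2 ^
0 = 1` would mean two balls. -/
theorem chainEntropyNumber_eq (W : Set X) (k : ℕ) :
    chainEntropyNumber W k = entropyNumber W (if k = 0 then 0 else 2 ^ k) := by
  unfold chainEntropyNumber entropyNumber
  split_ifs <;> simp

end CoveringRadius

/-! ### Dyadic condensation for antitone sequences. -/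

section DyadicSums

variable {u : ℕ → ℝ}

theorem two_rpow_half_sq (k : ℕ) : ((2 : ℝ) ^ ((k : ℝ) / 2)) ^ 2 = 2 ^ k := by
  rw [← Real.rpow_natCast, ← Real.rpow_mul (by norm_num), ← Real.rpow_natCast]
  congr 1
  push_cast
  ring

theorem two_rpow_half_mul_neg (k : ℕ) :
    (2 : ℝ) ^ ((k : ℝ) / 2) * ((2 : ℝ) ^ k) ^ (-(1 / 2) : ℝ) = 1 := by
  rw [← Real.rpow_natCast, ← Real.rpow_mul (by norm_num), ← Real.rpow_add (by norm_num)]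
  ring_nf
  simp

theorem two_rpow_half_succ_le (k : ℕ) :
    (2 : ℝ) ^ (((k + 1 : ℕ) : ℝ) / 2) ≤ 2 * (2 : ℝ) ^ ((k : ℝ) / 2) := by
  have h1 := two_rpow_half_sq (k + 1)
  have h2 := two_rpow_half_sq k
  have h0 : (0 : ℝ) < 2 ^ k := by positivity
  refine (sq_le_sq₀ (by positivity) (by positivity)).1 ?_
  rw [mul_pow, h1, h2, pow_succ]
  linarith

/-- The chain term `k = K + 1` is paid for by the block `2 ^ K < n ≤ 2 ^ (K + 1)`: its `2 ^ K` terms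
are each at least `2 ^ (-(K + 2) / 2) * u (2 ^ (K + 1))`, and the factor 4 absorbs the loss. -/
theorem chain_sum_le_sum (hu : Antitone u) (h0 : ∀ n, 0 ≤ u n) (K : ℕ) :
    ∑ k ∈ Finset.range (K + 1), (2 : ℝ) ^ ((k : ℝ) / 2) * u (if k = 0 then 0 else 2 ^ k) ≤
      4 * ∑ n ∈ Finset.range (2 ^ K + 1), ((n : ℝ) + 1) ^ (-(1 / 2) : ℝ) * u n := by
  induction K with
  | zero =>
    have := h0 0
    have h1 : 0 ≤ ((1 : ℝ) + 1) ^ (-(1 / 2) : ℝ) * u 1 := mul_nonneg (by positivity) (h0 1)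
    simp [Finset.sum_range_succ] at h1 ⊢
    linarith
  | succ K ih =>
    have hle : 2 ^ K + 1 ≤ 2 ^ (K + 1) + 1 := by gcongr <;> omega
    rw [Finset.sum_range_succ _ (K + 1), Finset.range_eq_Ico (a := 2 ^ (K + 1) + 1),
      ← Finset.sum_Ico_consecutive _ (Nat.zero_le _) hle, mul_add, ← Finset.range_eq_Ico]
    refine add_le_add ih ?_
    have hcard : (2 : ℝ) ^ K * (((2 : ℝ) ^ (K + 2)) ^ (-(1 / 2) : ℝ) * u (2 ^ (K + 1))) ≤
        ∑ n ∈ Finset.Ico (2 ^ K + 1 : ℕ) (2 ^ (K + 1) + 1),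
          ((n : ℝ) + 1) ^ (-(1 / 2) : ℝ) * u n := by
      have hc : (Finset.Ico (2 ^ K + 1) (2 ^ (K + 1) + 1)).card = 2 ^ K := by
        rw [Nat.card_Ico, pow_succ]; omega
      have := Finset.card_nsmul_le_sum (Finset.Ico (2 ^ K + 1) (2 ^ (K + 1) + 1))
        (fun n : ℕ => ((n : ℝ) + 1) ^ (-(1 / 2) : ℝ) * u n)
        (((2 : ℝ) ^ (K + 2)) ^ (-(1 / 2) : ℝ) * u (2 ^ (K + 1))) (fun n hn => by
          rw [Finset.mem_Ico] at hn
          have hn' : n ≤ 2 ^ (K + 1) := by omega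
          have hn2 : n + 1 ≤ 2 ^ (K + 2) := by
            have : 1 ≤ 2 ^ (K + 1) := Nat.one_le_two_pow
            rw [pow_succ _ (K + 1)]; omega
          refine mul_le_mul ?_ (hu hn') (h0 _) (by positivity)
          exact Real.rpow_le_rpow_of_nonpos (by positivity) (by exact_mod_cast hn2) (by norm_num))
      rw [hc, nsmul_eq_mul] at this
      exact_mod_cast this
    refine le_trans ?_ (mul_le_mul_of_nonneg_left hcard (by norm_num))
    rw [if_neg (Nat.succ_ne_zero K)]
    have hU := h0 (2 ^ (K + 1))
    have e1 := two_rpow_half_mul_neg (K + 2)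
    have e2 := two_rpow_half_succ_le K
    have e4 := two_rpow_half_sq K
    set a := (2 : ℝ) ^ ((K : ℝ) / 2)
    set b := (2 : ℝ) ^ (((K + 1 : ℕ) : ℝ) / 2)
    set c := (2 : ℝ) ^ (((K + 2 : ℕ) : ℝ) / 2) with hcdef
    set d := ((2 : ℝ) ^ (K + 2)) ^ (-(1 / 2) : ℝ)
    have hcc : c = 2 * a := by
      rw [hcdef]
      push_cast
      rw [add_div, Real.rpow_add (by norm_num)]
      norm_num
      ring
    have hd : 2 * (a * d) = 1 := by rw [← e1, hcc]; ring
    rw [← e4, ← mul_assoc, ← mul_assoc, show 4 * a ^ 2 * d = 2 * a * (2 * (a * d)) by ring, hd,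
      mul_one]
    exact mul_le_mul_of_nonneg_right e2 hU

/-- The block `2 ^ (K + 1) ≤ n < 2 ^ (K + 2)` costs at most the chain term `k = K + 1`. The factor 2
is needed only in the base case, where `n = 0` and `n = 1` are both charged to `u 0`. -/
theorem sum_le_chain_sum (hu : Antitone u) (h0 : ∀ n, 0 ≤ u n) (K : ℕ) :
    ∑ n ∈ Finset.range (2 ^ (K + 1)), ((n : ℝ) + 1) ^ (-(1 / 2) : ℝ) * u n ≤
      2 * ∑ k ∈ Finset.range (K + 1),
        (2 : ℝ) ^ ((k : ℝ) / 2) * u (if k = 0 then 0 else 2 ^ k) := by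
  induction K with
  | zero =>
    have h1 : ((1 : ℝ) + 1) ^ (-(1 / 2) : ℝ) * u 1 ≤ 1 * u 0 :=
      mul_le_mul (Real.rpow_le_one_of_one_le_of_nonpos (by norm_num) (by norm_num))
        (hu (Nat.zero_le 1)) (h0 1) (by norm_num)
    simp [Finset.sum_range_succ] at h1 ⊢
    linarith
  | succ K ih =>
    have hle : 2 ^ (K + 1) ≤ 2 ^ (K + 1 + 1) := by gcongr <;> omega
    rw [Finset.sum_range_succ _ (K + 1), Finset.range_eq_Ico (a := 2 ^ (K + 1 + 1)),
      ← Finset.sum_Ico_consecutive _ (Nat.zero_le _) hle, mul_add, ← Finset.range_eq_Ico]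
    refine add_le_add ih ?_
    have hc : (Finset.Ico (2 ^ (K + 1)) (2 ^ (K + 1 + 1))).card = 2 ^ (K + 1) := by
      rw [Nat.card_Ico, pow_succ _ (K + 1)]; omega
    have := Finset.sum_le_card_nsmul (Finset.Ico (2 ^ (K + 1)) (2 ^ (K + 1 + 1)))
      (fun n : ℕ => ((n : ℝ) + 1) ^ (-(1 / 2) : ℝ) * u n)
      (((2 : ℝ) ^ (K + 1)) ^ (-(1 / 2) : ℝ) * u (2 ^ (K + 1))) (fun n hn => by
        rw [Finset.mem_Ico] at hn
        refine mul_le_mul ?_ (hu hn.1) (h0 _) (by positivity)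
        refine Real.rpow_le_rpow_of_nonpos (by positivity) ?_ (by norm_num)
        exact_mod_cast hn.1.trans (Nat.le_succ n))
    rw [hc, nsmul_eq_mul] at this
    refine this.trans ?_
    rw [if_neg (Nat.succ_ne_zero K)]
    have hU := h0 (2 ^ (K + 1))
    have e1 := two_rpow_half_mul_neg (K + 1)
    have e4 := two_rpow_half_sq (K + 1)
    set b := (2 : ℝ) ^ (((K + 1 : ℕ) : ℝ) / 2)
    set d := ((2 : ℝ) ^ (K + 1)) ^ (-(1 / 2) : ℝ)
    have hb : 0 < b := by positivity
    push_cast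
    rw [← e4, ← mul_assoc, show b ^ 2 * d = b * (b * d) by ring, e1]
    nlinarith [mul_nonneg hb.le hU]

end DyadicSums

/-! ### Comparison of the two entropy sums, using `2 ^ K ≤ m < 2 ^ (K + 1)`. -/

section EntropySums

variable {X : Type*} [PseudoMetricSpace X] {W : Set X} {x : X} {D p : ℝ}

theorem entropyNumber_rpow_antitone (hx : x ∈ W) (hW : ∀ y ∈ W, dist y x ≤ D) (hp : 1 ≤ p) :
    Antitone fun n => entropyNumber W n ^ (min 2 p / 2) := fun a b hab =>
  Real.rpow_le_rpow (coveringRadius_nonneg _ _)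
    (coveringRadius_anti hx hW (by positivity) (by gcongr; norm_num))
    (div_nonneg (le_min (by norm_num) (by linarith)) (by norm_num))

theorem chainEntropySum_le_entropySum (hx : x ∈ W) (hW : ∀ y ∈ W, dist y x ≤ D) (hp : 1 ≤ p)
    {m : ℕ} (hm : 1 ≤ m) : chainEntropySum W p m ≤ 4 * entropySum W p m := by
  have h0 : ∀ n, 0 ≤ entropyNumber W n ^ (min 2 p / 2) := fun n =>
    Real.rpow_nonneg (coveringRadius_nonneg _ _) _
  unfold chainEntropySum entropySum
  simp only [chainEntropyNumber_eq]
  refine (chain_sum_le_sum (entropyNumber_rpow_antitone hx hW hp) h0 (Nat.log 2 m)).trans ?_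
  refine mul_le_mul_of_nonneg_left (Finset.sum_le_sum_of_subset_of_nonneg ?_ fun n _ _ =>
    mul_nonneg (by positivity) (h0 n)) (by norm_num)
  exact Finset.range_mono (Nat.succ_le_succ (Nat.pow_log_le_self 2 (by omega)))

theorem entropySum_le_chainEntropySum (hx : x ∈ W) (hW : ∀ y ∈ W, dist y x ≤ D) (hp : 1 ≤ p)
    (m : ℕ) : entropySum W p m ≤ 2 * chainEntropySum W p m := by
  have h0 : ∀ n, 0 ≤ entropyNumber W n ^ (min 2 p / 2) := fun n =>
    Real.rpow_nonneg (coveringRadius_nonneg _ _) _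
  unfold chainEntropySum entropySum
  simp only [chainEntropyNumber_eq]
  refine le_trans ?_ (sum_le_chain_sum (entropyNumber_rpow_antitone hx hW hp) h0 (Nat.log 2 m))
  refine Finset.sum_le_sum_of_subset_of_nonneg ?_ fun n _ _ =>
    mul_nonneg (by positivity) (h0 n)
  exact Finset.range_mono (Nat.lt_pow_succ_log_self (by norm_num) m)

end EntropySums

/-! ### Expected maximum of finitely many sub-Gaussian variables. -/

section SubgaussianMaximum

variable {S ι : Type*} [MeasurableSpace S] {P : Measure S} [Fintype ι] {Y : ι → S → ℝ}
  {c : NNReal} {t : ℝ}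

theorem integrable_iSup_abs (hY : ∀ i, HasSubgaussianMGF (Y i) c P) :
    Integrable (fun s => ⨆ i, |Y i s|) P := by
  have hint : ∀ i, Integrable (Y i) P := fun i => (hY i).integrable
  refine Integrable.mono' (g := fun s => ∑ i, |Y i s|)
    (integrable_finsetSum _ fun i _ => (hint i).abs) ?_ (ae_of_all _ fun s => ?_)
  · exact (AEMeasurable.iSup fun i => (hint i).abs.aemeasurable).aestronglyMeasurable
  · rw [Real.norm_of_nonneg (Real.iSup_nonneg fun i => abs_nonneg _)]
    exact Real.iSup_le (fun i => Finset.single_le_sum (f := fun i => |Y i s|)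
      (fun i _ => abs_nonneg _) (Finset.mem_univ i)) (Finset.sum_nonneg fun i _ => abs_nonneg _)

/-- Maximal inequality for finitely many sub-Gaussian variables. -/
theorem integral_iSup_abs_le [IsProbabilityMeasure P] [Nonempty ι]
    (hY : ∀ i, HasSubgaussianMGF (Y i) c P) (ht : 0 < t) :
    ∫ s, ⨆ i, |Y i s| ∂P ≤ Real.log (2 * Fintype.card ι) / t + c * t / 2 := by
  set A : ℝ := 2 * Fintype.card ι * Real.exp (c * t ^ 2 / 2) with hA
  have hN : (0 : ℝ) < Fintype.card ι := by exact_mod_cast Fintype.card_pos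
  have hA0 : 0 < A := by positivity
  set G : S → ℝ := fun s => ∑ i, (Real.exp (t * Y i s) + Real.exp (-t * Y i s)) with hG
  have hGint : Integrable G P := integrable_finsetSum _ fun i _ =>
    ((hY i).integrable_exp_mul t).add ((hY i).integrable_exp_mul (-t))
  have hGle : ∫ s, G s ∂P ≤ A := by
    have hi : ∀ i ∈ Finset.univ,
        Integrable (fun s => Real.exp (t * Y i s) + Real.exp (-t * Y i s)) P := fun i _ =>
      ((hY i).integrable_exp_mul t).add ((hY i).integrable_exp_mul (-t))
    rw [show ∫ s, G s ∂P = _ from integral_finsetSum _ hi]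
    have : ∀ i ∈ Finset.univ, ∫ s, (Real.exp (t * Y i s) + Real.exp (-t * Y i s)) ∂P ≤
        2 * Real.exp (c * t ^ 2 / 2) := fun i _ => by
      rw [integral_add ((hY i).integrable_exp_mul t) ((hY i).integrable_exp_mul (-t))]
      have h1 := (hY i).mgf_le t
      have h2 := (hY i).mgf_le (-t)
      rw [neg_sq] at h2
      simp only [mgf] at h1 h2
      linarith
    refine (Finset.sum_le_card_nsmul _ _ _ this).trans_eq ?_
    rw [nsmul_eq_mul, hA, Finset.card_univ]
    ring
  -- The tangent line of `log` at `A` replaces Jensen's inequality: the bound is affine in `G`, so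
  -- its integral needs only `∫ G ≤ A`.
  have hpt : ∀ s, ⨆ i, |Y i s| ≤ (Real.log A - 1 + G s / A) / t := fun s => by
    refine ciSup_le fun i => ?_
    rw [le_div_iff₀ ht]
    have h1 : Real.exp (t * |Y i s|) ≤ G s := by
      refine le_trans ?_ (Finset.single_le_sum
        (f := fun i => Real.exp (t * Y i s) + Real.exp (-t * Y i s))
        (fun i _ => by positivity) (Finset.mem_univ i))
      rcases abs_cases (Y i s) with ⟨h, _⟩ | ⟨h, _⟩ <;> rw [h]
      · exact le_add_of_nonneg_right (Real.exp_pos _).le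
      · rw [mul_neg, ← neg_mul]
        exact le_add_of_nonneg_left (Real.exp_pos _).le
    have h2 := Real.log_le_sub_one_of_pos (div_pos (Real.exp_pos (t * |Y i s|)) hA0)
    rw [Real.log_div (Real.exp_pos _).ne' hA0.ne', Real.log_exp] at h2
    have h3 : Real.exp (t * |Y i s|) / A ≤ G s / A := by gcongr
    linarith
  have hI : Integrable (fun s => (Real.log A - 1 + G s / A) / t) P :=
    ((integrable_const _).add (hGint.div_const A)).div_const t
  refine (integral_mono (integrable_iSup_abs hY) hI hpt).trans ?_
  rw [integral_div, integral_add (integrable_const _) (hGint.div_const A), integral_div,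
    integral_const]
  have h4 : (∫ s, G s ∂P) / A ≤ 1 := (div_le_one hA0).2 hGle
  have h5 : Real.log A = Real.log (2 * Fintype.card ι) + c * t ^ 2 / 2 := by
    rw [hA, Real.log_mul (by positivity) (Real.exp_pos _).ne', Real.log_exp]
  calc _ ≤ Real.log A / t := by
        gcongr
        simp
        linarith
    _ = _ := by rw [h5]; field_simp

end SubgaussianMaximum

/-! ### The signed sampling error: Lipschitz and sub-Gaussian increments. -/

section PowerDeviation

theorem abs_rpow_sub_rpow_le {p M a b : ℝ} (hp : 1 ≤ p) (ha : 0 ≤ a) (haM : a ≤ M) (hb : 0 ≤ b)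
    (hbM : b ≤ M) : |a ^ p - b ^ p| ≤ p * M ^ (p - 1) * |a - b| := by
  have := (convex_Icc (0 : ℝ) M).norm_image_sub_le_of_norm_hasDerivWithin_le
    (f := fun x : ℝ => x ^ p) (f' := fun x => p * x ^ (p - 1)) (C := p * M ^ (p - 1))
    (fun x _ => (Real.hasDerivAt_rpow_const (Or.inr hp)).hasDerivWithinAt)
    (fun x hx => by
      have := hx.1
      rw [Real.norm_of_nonneg (by positivity)]
      gcongr
      exact hx.2)
    (show b ∈ Set.Icc 0 M from ⟨hb, hbM⟩) (show a ∈ Set.Icc 0 M from ⟨ha, haM⟩)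
  simpa [Real.norm_eq_abs] using this

variable {Ω 𝕜 : Type*} [TopologicalSpace Ω] [RCLike 𝕜] {p M L d : ℝ} {m : ℕ}

theorem continuous_norm_rpow (hp : 1 ≤ p) (f : C(Ω, 𝕜)) : Continuous fun x => ‖f x‖ ^ p :=
  f.continuous.norm.rpow_const fun _ => Or.inr (by linarith)

section Definition

variable [MeasurableSpace Ω] {μ : Measure Ω}

/-- The signed error of the sample mean of `‖f‖ ^ p`. -/
noncomputable def powDeviation (μ : Measure Ω) (p : ℝ) (ξ : Fin m → Ω) (f : C(Ω, 𝕜)) : ℝ :=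
  (1 / (m : ℝ)) * ∑ j, ‖f (ξ j)‖ ^ p - ∫ x, ‖f x‖ ^ p ∂μ

theorem powDeviation_zero (hp : 1 ≤ p) (ξ : Fin m → Ω) :
    powDeviation μ p ξ (0 : C(Ω, 𝕜)) = 0 := by
  simp [powDeviation, Real.zero_rpow (by linarith : p ≠ 0)]

theorem samplingError_nonneg (μ : Measure Ω) (W : Set C(Ω, 𝕜)) (p : ℝ) (ξ : Fin m → Ω) :
    0 ≤ samplingError μ W p ξ := Real.iSup_nonneg fun _ => abs_nonneg _

variable [BorelSpace Ω] {S : Type*} [MeasurableSpace S] {P : Measure S} {X : Fin m → S → Ω}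

theorem aemeasurable_powDeviation (hp : 1 ≤ p) (hX : ∀ j, HasLaw (X j) μ P) (f : C(Ω, 𝕜)) :
    AEMeasurable (fun s => powDeviation μ p (fun j => X j s) f) P := by
  unfold powDeviation
  refine (AEMeasurable.const_mul (Finset.aemeasurable_fun_sum _ fun j _ => ?_) _).sub_const _
  exact (continuous_norm_rpow hp f).measurable.comp_aemeasurable (hX j).aemeasurable

end Definition

variable [CompactSpace Ω]

theorem abs_norm_rpow_sub_le (hp : 1 ≤ p) (hL : p * M ^ (p - 1) ≤ L) {f g : C(Ω, 𝕜)}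
    (hf : ‖f‖ ≤ M) (hg : ‖g‖ ≤ M) (x : Ω) :
    |‖f x‖ ^ p - ‖g x‖ ^ p| ≤ L * ‖f - g‖ := by
  have hM : 0 ≤ M := (norm_nonneg f).trans hf
  refine (abs_rpow_sub_rpow_le hp (norm_nonneg _) ((f.norm_coe_le_norm x).trans hf) (norm_nonneg _)
    ((g.norm_coe_le_norm x).trans hg)).trans ?_
  refine mul_le_mul hL ?_ (abs_nonneg _) (le_trans (by positivity) hL)
  exact (abs_norm_sub_norm_le _ _).trans ((f - g).norm_coe_le_norm x)

variable [MeasurableSpace Ω] [BorelSpace Ω] {μ : Measure Ω} [IsProbabilityMeasure μ]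

theorem integrable_norm_rpow (hp : 1 ≤ p) (f : C(Ω, 𝕜)) : Integrable (fun x => ‖f x‖ ^ p) μ :=
  (continuous_norm_rpow hp f).integrable_of_hasCompactSupport
    (HasCompactSupport.of_compactSpace _)

/-- Exhibits the increment as a mean of centred terms, the form used for both the deterministic and
the Hoeffding bound. -/
theorem powDeviation_sub (hp : 1 ≤ p) (hm : 1 ≤ m) (ξ : Fin m → Ω) (f g : C(Ω, 𝕜)) :
    powDeviation μ p ξ f - powDeviation μ p ξ g =
      (1 / (m : ℝ)) * ∑ j, ((‖f (ξ j)‖ ^ p - ‖g (ξ j)‖ ^ p) -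
        ∫ x, (‖f x‖ ^ p - ‖g x‖ ^ p) ∂μ) := by
  have hm' : (m : ℝ) ≠ 0 := by positivity
  rw [integral_sub (integrable_norm_rpow hp f) (integrable_norm_rpow hp g),
    Finset.sum_sub_distrib, Finset.sum_sub_distrib]
  simp only [powDeviation, Finset.sum_const, Finset.card_univ, Fintype.card_fin, nsmul_eq_mul]
  field_simp
  ring

theorem abs_powDeviation_sub_le (hp : 1 ≤ p) (hL : p * M ^ (p - 1) ≤ L) (hm : 1 ≤ m)
    (ξ : Fin m → Ω) {f g : C(Ω, 𝕜)} (hf : ‖f‖ ≤ M) (hg : ‖g‖ ≤ M) :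
    |powDeviation μ p ξ f - powDeviation μ p ξ g| ≤ 2 * L * ‖f - g‖ := by
  have hm' : (0 : ℝ) < m := by positivity
  have hpt := abs_norm_rpow_sub_le hp hL hf hg
  have hint : |∫ x, (‖f x‖ ^ p - ‖g x‖ ^ p) ∂μ| ≤ L * ‖f - g‖ := by
    have := norm_integral_le_of_norm_le_const (μ := μ)
      (f := fun x => ‖f x‖ ^ p - ‖g x‖ ^ p) (ae_of_all _ hpt)
    simpa using this
  rw [powDeviation_sub hp hm, abs_mul, abs_of_pos (by positivity), one_div_mul_eq_div,
    div_le_iff₀ hm']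
  refine (Finset.abs_sum_le_sum_abs _ _).trans ?_
  refine (Finset.sum_le_card_nsmul _ _ (2 * L * ‖f - g‖) fun j _ => ?_).trans_eq ?_
  · refine (abs_sub _ _).trans ?_
    linarith [hpt (ξ j)]
  · simp [mul_comm]

variable {S : Type*} [MeasurableSpace S] {P : Measure S} [IsProbabilityMeasure P]
  {X : Fin m → S → Ω}

/-- Each centred summand comes from a variable with values in an interval of length `2 * L * d`,
hence has proxy `(L * d) ^ 2`. Adding `m` independent ones and scaling by `1 / m` divides this by
`m`. -/
theorem hasSubgaussianMGF_powDeviation_sub (hp : 1 ≤ p) (hL : p * M ^ (p - 1) ≤ L) (hm : 1 ≤ m)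
    (hX : ∀ j, HasLaw (X j) μ P) (hindep : iIndepFun X P) {f g : C(Ω, 𝕜)} (hf : ‖f‖ ≤ M)
    (hg : ‖g‖ ≤ M) (hfg : ‖f - g‖ ≤ d) :
    HasSubgaussianMGF (fun s => powDeviation μ p (fun j => X j s) f -
      powDeviation μ p (fun j => X j s) g) (Real.toNNReal ((L * d) ^ 2 / m)) P := by
  have hm' : (0 : ℝ) < m := by positivity
  have hL0 : 0 ≤ L := by
    have : 0 ≤ M := (norm_nonneg f).trans hf
    exact le_trans (by positivity) hL
  set h : Ω → ℝ := fun x => ‖f x‖ ^ p - ‖g x‖ ^ p with hh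
  have hcont : Continuous h := (continuous_norm_rpow hp f).sub (continuous_norm_rpow hp g)
  have hbd : ∀ x, h x ∈ Set.Icc (-(L * d)) (L * d) := fun x =>
    abs_le.1 ((abs_norm_rpow_sub_le hp hL hf hg x).trans (by gcongr))
  have hsub : ∀ j ∈ Finset.univ, HasSubgaussianMGF (fun s => (h (X j s) - ∫ x, h x ∂μ))
      ((‖L * d - -(L * d)‖₊ / 2) ^ 2) P := fun j _ => by
    have h1 := hasSubgaussianMGF_of_mem_Icc (μ := P) (X := fun s => h (X j s))
      (hcont.measurable.comp_aemeasurable (hX j).aemeasurable)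
      (ae_of_all _ fun s => hbd (X j s))
    have h2 : ∫ s, h (X j s) ∂P = ∫ x, h x ∂μ :=
      (hX j).integral_comp hcont.measurable.aestronglyMeasurable
    rwa [h2] at h1
  have hind : iIndepFun (fun j s => h (X j s) - ∫ x, h x ∂μ) P :=
    hindep.comp (fun _ x => h x - ∫ x, h x ∂μ) fun _ => hcont.measurable.sub_const _
  have key := (HasSubgaussianMGF.sum_of_iIndepFun hind hsub).const_mul (1 / (m : ℝ))
  have hc : NNReal.mk ((1 / (m : ℝ)) ^ 2) (sq_nonneg _) *
      ∑ j : Fin m, (‖L * d - -(L * d)‖₊ / 2) ^ 2 = Real.toNNReal ((L * d) ^ 2 / m) := by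
    apply NNReal.eq
    rw [Real.coe_toNNReal _ (by positivity)]
    simp only [sub_neg_eq_add, Finset.sum_const, Finset.card_univ, Fintype.card_fin, nsmul_eq_mul,
      NNReal.coe_mul, NNReal.coe_mk, NNReal.coe_natCast, NNReal.coe_pow, NNReal.coe_div,
      coe_nnnorm, NNReal.coe_ofNat, Real.norm_eq_abs]
    rw [div_pow _ (2 : ℝ), sq_abs]
    field_simp
    ring
  rw [← hc]
  exact key.congr (ae_of_all _ fun s => (powDeviation_sub hp hm _ f g).symm)

end PowerDeviation

/-! ### Measurability and integrability of the uniform error. -/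

section SamplingError

variable {Ω 𝕜 : Type*} [TopologicalSpace Ω] [CompactSpace Ω] [RCLike 𝕜] [MeasurableSpace Ω]
  [BorelSpace Ω] {μ : Measure Ω} [IsProbabilityMeasure μ] {p M : ℝ} {W : Set C(Ω, 𝕜)} {m : ℕ}

theorem abs_powDeviation_le (hp : 1 ≤ p) (hm : 1 ≤ m) (ξ : Fin m → Ω) {f : C(Ω, 𝕜)}
    (hf : ‖f‖ ≤ M) : |powDeviation μ p ξ f| ≤ 2 * (p * M ^ (p - 1)) * M := by
  have hM : 0 ≤ M := (norm_nonneg f).trans hf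
  have := abs_powDeviation_sub_le (μ := μ) (g := (0 : C(Ω, 𝕜))) hp le_rfl hm ξ hf (by simpa)
  rw [powDeviation_zero hp, sub_zero, sub_zero] at this
  exact this.trans (by gcongr)

theorem continuous_powDeviation (hp : 1 ≤ p) (hm : 1 ≤ m) (hW : ∀ f ∈ W, ‖f‖ ≤ M)
    (ξ : Fin m → Ω) : Continuous fun f : W => powDeviation μ p ξ (f : C(Ω, 𝕜)) := by
  refine (LipschitzWith.of_dist_le_mul (K := Real.toNNReal (2 * (p * M ^ (p - 1))))
    fun f g => ?_).continuous
  have hM : 0 ≤ M := (norm_nonneg _).trans (hW f f.2)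
  rw [Real.coe_toNNReal _ (by positivity), Real.dist_eq, Subtype.dist_eq, dist_eq_norm]
  exact abs_powDeviation_sub_le hp le_rfl hm ξ (hW f f.2) (hW g g.2)

variable [TopologicalSpace.MetrizableSpace Ω] {S : Type*} [MeasurableSpace S] {P : Measure S}
  {X : Fin m → S → Ω}

/-- `W` may be uncountable, but `C(Ω, 𝕜)` is second countable for compact metrizable `Ω` and the
error is continuous in `f`, so a countable dense subset gives the same supremum. -/
theorem aemeasurable_samplingError (hp : 1 ≤ p) (hm : 1 ≤ m) (hW : ∀ f ∈ W, ‖f‖ ≤ M)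
    (hX : ∀ j, HasLaw (X j) μ P) :
    AEMeasurable (fun s => samplingError μ W p fun j => X j s) P := by
  let _ : MetricSpace Ω := TopologicalSpace.metrizableSpaceMetric Ω
  obtain ⟨T, hTc, hTd⟩ := TopologicalSpace.exists_countable_dense W
  have : Countable T := hTc
  have heq : (fun s => samplingError μ W p fun j => X j s) =
      fun s => ⨆ f : T, |powDeviation μ p (fun j => X j s) (f : C(Ω, 𝕜))| := by
    funext s
    exact (hTd.ciSup' (continuous_powDeviation hp hm hW fun j => X j s).abs).symm
  rw [heq]
  exact AEMeasurable.iSup fun f => (aemeasurable_powDeviation hp hX _).abs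

variable [IsProbabilityMeasure P]

theorem integrable_samplingError (hp : 1 ≤ p) (hm : 1 ≤ m) (hW : ∀ f ∈ W, ‖f‖ ≤ M)
    (hW0 : (0 : C(Ω, 𝕜)) ∈ W) (hX : ∀ j, HasLaw (X j) μ P) :
    Integrable (fun s => samplingError μ W p fun j => X j s) P := by
  refine Integrable.of_bound (aemeasurable_samplingError hp hm hW hX).aestronglyMeasurable
    (2 * (p * M ^ (p - 1)) * M) (ae_of_all _ fun s => ?_)
  have : Nonempty W := ⟨0, hW0⟩
  rw [Real.norm_of_nonneg (samplingError_nonneg _ _ _ _)]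
  exact ciSup_le fun f => abs_powDeviation_le hp hm _ (hW f f.2)

theorem discretizationNumber_le_integral (hp : 1 ≤ p) (hm : 1 ≤ m) (hW : ∀ f ∈ W, ‖f‖ ≤ M)
    (hW0 : (0 : C(Ω, 𝕜)) ∈ W) (hX : ∀ j, HasLaw (X j) μ P) :
    discretizationNumber μ W p m ≤ ∫ s, samplingError μ W p (fun j => X j s) ∂P := by
  have h := integral_mono (μ := P) (integrable_const (discretizationNumber μ W p m))
    (integrable_samplingError hp hm hW hW0 hX) fun s => ciInf_le
      ⟨0, Set.forall_mem_range.2 fun ξ => samplingError_nonneg μ W p ξ⟩ fun j => X j s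
  simpa using h

end SamplingError

/-! ### The chaining argument. -/

section Chaining

/-- As `0 ∈ W`, the ball of radius `M` about `0` covers `W`, so `e_k ≤ M`. For `p ≤ 2` the spare
factor `e_k ^ (1 - p / 2)` is at most `M ^ (1 - p / 2)`; for `p ≥ 2` the two sides agree. -/
theorem rpow_mul_chainEntropyNumber_le {Ω 𝕜 : Type*} [TopologicalSpace Ω] [CompactSpace Ω]
    [RCLike 𝕜] {p M : ℝ} {W : Set C(Ω, 𝕜)} (hp : 1 ≤ p) (hW : ∀ f ∈ W, ‖f‖ ≤ M)
    (hW0 : (0 : C(Ω, 𝕜)) ∈ W) (k : ℕ) :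
    M ^ (p - 1) * chainEntropyNumber W k ≤
      M ^ max (p / 2) (p - 1) * chainEntropyNumber W k ^ (min 2 p / 2) := by
  have hM : 0 ≤ M := (norm_nonneg _).trans (hW 0 hW0)
  have he : 0 ≤ chainEntropyNumber W k := coveringRadius_nonneg _ _
  have heM : chainEntropyNumber W k ≤ M :=
    coveringRadius_le hW0 hM (fun f hf => by simpa using hW f hf) (by split_ifs <;> positivity)
  set e := chainEntropyNumber W k
  rcases le_total p 2 with h | h
  · rw [min_eq_right h, max_eq_left (by linarith)]
    have h1 : M ^ (p / 2) = M ^ (p - 1) * M ^ (1 - p / 2) := by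
      rw [← Real.rpow_add_of_nonneg hM (by linarith) (by linarith)]
      ring_nf
    have h2 : e = e ^ (1 - p / 2) * e ^ (p / 2) := by
      rw [← Real.rpow_add_of_nonneg he (by linarith) (by linarith)]
      ring_nf
      simp
    rw [h1, mul_assoc]
    nth_rewrite 1 [h2]
    gcongr
    linarith
  · rw [min_eq_left h, max_eq_right (by linarith), div_self (by norm_num), Real.rpow_one]

variable {Ω 𝕜 : Type*} [TopologicalSpace Ω] [CompactSpace Ω] [RCLike 𝕜] [MeasurableSpace Ω]
  [BorelSpace Ω] {μ : Measure Ω} [IsProbabilityMeasure μ] {p M : ℝ} {W : Set C(Ω, 𝕜)} {m : ℕ}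
  [TopologicalSpace.MetrizableSpace Ω] {S : Type*} [MeasurableSpace S] {P : Measure S}
  [IsProbabilityMeasure P] {X : Fin m → S → Ω}

theorem integral_chain_level_le {ι : Type*} [Fintype ι] [Nonempty ι] {Y : ι → S → ℝ} {L r : ℝ}
    (hL : 0 < L) (hr : 0 < r) (hm : 1 ≤ m) (k : ℕ) (hι : Fintype.card ι = 2 ^ 2 ^ (k + 1))
    (hY : ∀ i, HasSubgaussianMGF (Y i) (Real.toNNReal ((L * r) ^ 2 / m)) P) :
    ∫ s, ⨆ i, |Y i s| ∂P ≤ 5 * L * (√m)⁻¹ * ((2 : ℝ) ^ ((k : ℝ) / 2) * r) := by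
  have hm' : (0 : ℝ) < m := by positivity
  set q := √(m : ℝ)
  have hq : 0 < q := Real.sqrt_pos.2 hm'
  have hqm : (m : ℝ) = q ^ 2 := (Real.sq_sqrt hm'.le).symm
  have hab := two_rpow_half_succ_le k
  have hb2 := two_rpow_half_sq (k + 1)
  set a := (2 : ℝ) ^ ((k : ℝ) / 2)
  set b := (2 : ℝ) ^ (((k + 1 : ℕ) : ℝ) / 2)
  have hb : 0 < b := by positivity
  -- With `log (2 * N) ≤ 2 * b ^ 2`, this `t` gives both terms of the maximal inequality the order
  -- `b * L * r / √m`. The constants are `2 + 1 / 2`, then doubled by `b ≤ 2 * a`.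
  have h := integral_iSup_abs_le hY (t := b * q / (L * r)) (by positivity)
  refine h.trans ?_
  rw [Real.coe_toNNReal _ (by positivity), hι]
  have hlog : Real.log (2 * ((2 ^ 2 ^ (k + 1) : ℕ) : ℝ)) ≤ 2 * b ^ 2 := by
    push_cast
    rw [← pow_succ', Real.log_pow, hb2]
    have h1 : (1 : ℝ) ≤ 2 ^ (k + 1) := one_le_pow₀ (by norm_num)
    have h2 := Real.log_two_lt_d9
    have h3 : 0 < Real.log 2 := Real.log_pos (by norm_num)
    push_cast
    nlinarith
  calc _ ≤ 2 * b ^ 2 / (b * q / (L * r)) + (L * r) ^ 2 / m * (b * q / (L * r)) / 2 := by gcongr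
    _ = 5 / 2 * L * q⁻¹ * (b * r) := by
      rw [hqm]
      field_simp
      ring
    _ ≤ 5 / 2 * L * q⁻¹ * (2 * a * r) := by gcongr
    _ = _ := by ring

/-- The slack `η` provides near-optimal nets and keeps `L` and every `r k` positive, even when `M =
0` or an entropy number vanishes. -/
theorem integral_samplingError_le_of_pos (hp : 1 ≤ p) (hm : 1 ≤ m) (hW : ∀ f ∈ W, ‖f‖ ≤ M)
    (hW0 : (0 : C(Ω, 𝕜)) ∈ W) (hX : ∀ j, HasLaw (X j) μ P) (hindep : iIndepFun X P) {η : ℝ}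
    (hη : 0 < η) :
    ∫ s, samplingError μ W p (fun j => X j s) ∂P ≤
      10 * (p * M ^ (p - 1) + η) * (√m)⁻¹ * ∑ k ∈ Finset.range (Nat.log 2 m + 1),
        (2 : ℝ) ^ ((k : ℝ) / 2) * (chainEntropyNumber W k + η) := by
  have hM : 0 ≤ M := (norm_nonneg _).trans (hW 0 hW0)
  have hdist : ∀ f ∈ W, dist f 0 ≤ M := fun f hf => by simpa using hW f hf
  have hm' : (0 : ℝ) < m := by positivity
  set L := p * M ^ (p - 1) + η with hLdef
  have hL : 0 < L := by positivity
  have hL' : p * M ^ (p - 1) ≤ L := by linarith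
  -- The factor 2 is for level 0, where the net's only centre is replaced by `0` to start the chain
  -- at zero error; the triangle inequality doubles the radius.
  set r : ℕ → ℝ := fun k => 2 * (chainEntropyNumber W k + η) with hrdef
  have hr : ∀ k, 0 < r k := fun k => by
    have : 0 ≤ chainEntropyNumber W k := coveringRadius_nonneg _ _
    positivity
  have hnet : ∀ k, ∃ y : Fin (if k = 0 then 1 else 2 ^ 2 ^ k) → C(Ω, 𝕜), (∀ j, y j ∈ W) ∧
      (∀ w ∈ W, ∃ j, dist w (y j) ≤ r k) ∧ (k = 0 → ∀ j, y j = 0) := fun k => by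
    obtain ⟨y, hy, hc⟩ := exists_net hW0 hdist
      (N := if k = 0 then 1 else 2 ^ 2 ^ k) (by split_ifs <;> positivity) hη
    change ∀ w ∈ W, ∃ j, dist w (y j) ≤ chainEntropyNumber W k + η at hc
    have hrk := hr k
    rcases eq_or_ne k 0 with rfl | hk
    · refine ⟨fun _ => 0, fun _ => hW0, fun w hw => ⟨0, ?_⟩, fun _ _ => rfl⟩
      obtain ⟨i, hi⟩ := hc w hw
      obtain ⟨j, hj⟩ := hc 0 hW0
      have hij : i = j := Subsingleton.elim (α := Fin 1) i j
      subst hij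
      have := dist_triangle_right w 0 (y i)
      simp only [hrdef]
      linarith
    · refine ⟨y, hy, fun w hw => (hc w hw).imp fun j hj => ?_, fun h => absurd h hk⟩
      simp only [hrdef] at hrk ⊢
      linarith
  choose y hyW hyc hy0 using hnet
  choose q hq using hyc
  -- A link is determined by its upper endpoint, so level `k` has only `2 ^ 2 ^ (k + 1)` links.
  set V : (k : ℕ) → Fin (if k + 1 = 0 then 1 else 2 ^ 2 ^ (k + 1)) → S → ℝ := fun k j s =>
    powDeviation μ p (fun j => X j s) (y (k + 1) j) -
      powDeviation μ p (fun j => X j s) (y k (q k (y (k + 1) j) (hyW (k + 1) j))) with hV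
  have hVsub : ∀ k j, HasSubgaussianMGF (V k j) (Real.toNNReal ((L * r k) ^ 2 / m)) P :=
    fun k j => hasSubgaussianMGF_powDeviation_sub hp hL' hm hX hindep (hW _ (hyW _ _))
      (hW _ (hyW _ _)) (by rw [← dist_eq_norm]; exact hq k _ (hyW (k + 1) j))
  set B : ℕ → S → ℝ := fun k s => ⨆ j, |V k j s| with hB
  have hBint : ∀ k, Integrable (B k) P := fun k => integrable_iSup_abs (hVsub k)
  have hBle : ∀ k, ∫ s, B k s ∂P ≤ 5 * L * (√m)⁻¹ * ((2 : ℝ) ^ ((k : ℝ) / 2) * r k) := fun k => by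
    have : Nonempty (Fin (if k + 1 = 0 then 1 else 2 ^ 2 ^ (k + 1))) :=
      ⟨⟨0, by split_ifs <;> positivity⟩⟩
    exact integral_chain_level_le hL (hr k) hm k (by simp) (hVsub k)
  have hchain : ∀ s k j, |powDeviation μ p (fun j => X j s) (y k j)| ≤
      ∑ i ∈ Finset.range k, B i s := fun s k => by
    induction k with
    | zero => intro j; simp [hy0 0 rfl j, powDeviation_zero hp]
    | succ k ih =>
      intro j
      rw [Finset.sum_range_succ]
      have h1 := ih (q k (y (k + 1) j) (hyW (k + 1) j))
      have h2 : |V k j s| ≤ B k s :=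
        le_ciSup (f := fun j => |V k j s|) (Set.finite_range _).bddAbove j
      have h3 := abs_sub_abs_le_abs_sub (powDeviation μ p (fun j => X j s) (y (k + 1) j))
        (powDeviation μ p (fun j => X j s) (y k (q k (y (k + 1) j) (hyW (k + 1) j))))
      simp only [hV] at h2
      linarith
  set K := Nat.log 2 m
  have hpt : ∀ s, samplingError μ W p (fun j => X j s) ≤
      ∑ i ∈ Finset.range K, B i s + 2 * L * r K := fun s => by
    have : Nonempty W := ⟨0, hW0⟩
    refine ciSup_le fun f => ?_
    change |powDeviation μ p (fun j => X j s) (f : C(Ω, 𝕜))| ≤ _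
    have h1 := hchain s K (q K f f.2)
    have h2 := abs_powDeviation_sub_le (μ := μ) hp hL' hm (fun j => X j s) (hW f f.2)
      (hW _ (hyW K (q K f f.2)))
    have h3 := abs_sub_abs_le_abs_sub (powDeviation μ p (fun j => X j s) (f : C(Ω, 𝕜)))
      (powDeviation μ p (fun j => X j s) (y K (q K f f.2)))
    have h4 := hq K f f.2
    rw [dist_eq_norm] at h4
    have h5 : 2 * L * ‖(f : C(Ω, 𝕜)) - y K (q K f f.2)‖ ≤ 2 * L * r K := by gcongr
    linarith
  -- Since `m < 2 ^ (K + 1)`, `√m ≤ 2 * 2 ^ (K / 2)`. The deterministic remainder thus has the form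
  -- of a chain term for `k = K`, with constant 4 in place of 5.
  have hlast : 2 * L * r K ≤ 5 * L * (√m)⁻¹ * ((2 : ℝ) ^ ((K : ℝ) / 2) * r K) := by
    have h1 : √(m : ℝ) ≤ 2 * (2 : ℝ) ^ ((K : ℝ) / 2) := by
      refine le_trans ?_ (two_rpow_half_succ_le K)
      rw [Real.sqrt_le_left (by positivity), two_rpow_half_sq]
      exact_mod_cast (Nat.lt_pow_succ_log_self (by norm_num) m).le
    have h2 : 1 ≤ 2 * (2 : ℝ) ^ ((K : ℝ) / 2) * (√m)⁻¹ := by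
      rwa [← div_eq_mul_inv, one_le_div (Real.sqrt_pos.2 hm')]
    have h3 : 0 ≤ L * r K := mul_nonneg hL.le (hr K).le
    have h4 : 0 ≤ (2 : ℝ) ^ ((K : ℝ) / 2) * (√m)⁻¹ := by positivity
    nlinarith [mul_le_mul_of_nonneg_left h2 h3, mul_nonneg h3 h4]
  have hsumint := integrable_finsetSum (μ := P) (Finset.range K) fun i _ => hBint i
  calc _ ≤ ∫ s, (∑ i ∈ Finset.range K, B i s + 2 * L * r K) ∂P :=
        integral_mono (integrable_samplingError hp hm hW hW0 hX)
          (hsumint.add (integrable_const _)) hpt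
    _ = ∑ i ∈ Finset.range K, ∫ s, B i s ∂P + 2 * L * r K := by
        rw [integral_add hsumint (integrable_const _), integral_finsetSum _ fun i _ => hBint i]
        simp
    _ ≤ ∑ i ∈ Finset.range K, 5 * L * (√m)⁻¹ * ((2 : ℝ) ^ ((i : ℝ) / 2) * r i) +
          5 * L * (√m)⁻¹ * ((2 : ℝ) ^ ((K : ℝ) / 2) * r K) :=
        add_le_add (Finset.sum_le_sum fun i _ => hBle i) hlast
    _ = _ := by
        rw [← Finset.sum_range_succ (fun i : ℕ =>
          5 * L * (√m)⁻¹ * ((2 : ℝ) ^ ((i : ℝ) / 2) * r i)), Finset.mul_sum]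
        refine Finset.sum_congr rfl fun i _ => ?_
        simp only [hrdef]
        ring

/-- The limit `η → 0+`, by continuity of the right-hand side in `η`. -/
theorem integral_samplingError_le (hp : 1 ≤ p) (hm : 1 ≤ m) (hW : ∀ f ∈ W, ‖f‖ ≤ M)
    (hW0 : (0 : C(Ω, 𝕜)) ∈ W) (hX : ∀ j, HasLaw (X j) μ P) (hindep : iIndepFun X P) :
    ∫ s, samplingError μ W p (fun j => X j s) ∂P ≤
      10 * (p * M ^ (p - 1)) * (√m)⁻¹ * ∑ k ∈ Finset.range (Nat.log 2 m + 1),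
        (2 : ℝ) ^ ((k : ℝ) / 2) * chainEntropyNumber W k := by
  set F : ℝ → ℝ := fun η => 10 * (p * M ^ (p - 1) + η) * (√m)⁻¹ *
    ∑ k ∈ Finset.range (Nat.log 2 m + 1), (2 : ℝ) ^ ((k : ℝ) / 2) * (chainEntropyNumber W k + η)
    with hF
  have hc : Continuous F := by fun_prop
  have h0 := ge_of_tendsto (hc.continuousWithinAt (s := Set.Ioi 0) (x := 0))
    (Filter.eventually_of_mem self_mem_nhdsWithin fun η hη =>
      integral_samplingError_le_of_pos hp hm hW hW0 hX hindep hη)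
  simpa [hF] using h0

theorem integral_samplingError_le_chainEntropySum (hp : 1 ≤ p) (hm : 1 ≤ m)
    (hW : ∀ f ∈ W, ‖f‖ ≤ M) (hW0 : (0 : C(Ω, 𝕜)) ∈ W) (hX : ∀ j, HasLaw (X j) μ P)
    (hindep : iIndepFun X P) :
    ∫ s, samplingError μ W p (fun j => X j s) ∂P ≤
      10 * p ^ 2 * M ^ max (p / 2) (p - 1) * (m : ℝ) ^ (-(1 / 2) : ℝ) * chainEntropySum W p m := by
  refine (integral_samplingError_le hp hm hW hW0 hX hindep).trans ?_
  have hM : 0 ≤ M := (norm_nonneg _).trans (hW 0 hW0)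
  rw [Real.rpow_neg (by positivity), ← Real.sqrt_eq_rpow, chainEntropySum, Finset.mul_sum,
    Finset.mul_sum]
  refine Finset.sum_le_sum fun k _ => ?_
  have he : 0 ≤ chainEntropyNumber W k := coveringRadius_nonneg _ _
  calc _ = 10 * p * (√m)⁻¹ * (2 : ℝ) ^ ((k : ℝ) / 2) * (M ^ (p - 1) * chainEntropyNumber W k) := by
        ring
    _ ≤ 10 * p ^ 2 * (√m)⁻¹ * (2 : ℝ) ^ ((k : ℝ) / 2) *
        (M ^ max (p / 2) (p - 1) * chainEntropyNumber W k ^ (min 2 p / 2)) := by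
        have hpp : p ≤ p ^ 2 := le_self_pow₀ hp (by norm_num)
        exact mul_le_mul (by gcongr) (rpow_mul_chainEntropyNumber_le hp hW hW0 k)
          (by positivity) (by positivity)
    _ = _ := by ring

end Chaining

theorem theorem2p2 :
    ∃ C : ℝ, 0 < C ∧
      ∀ (𝕜 : Type*) [RCLike 𝕜]
        (Ω : Type*) [TopologicalSpace Ω] [CompactSpace Ω] [TopologicalSpace.MetrizableSpace Ω]
        [MeasurableSpace Ω] [BorelSpace Ω]
        (μ : Measure Ω) [IsProbabilityMeasure μ]
        (p : ℝ) (_ : 1 ≤ p) (M : ℝ) (W : Set C(Ω, 𝕜))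
        (_ : ∀ f ∈ W, ‖f‖ ≤ M) (_ : (0 : C(Ω, 𝕜)) ∈ W)
        (m : ℕ) (_ : 1 ≤ m)
        (S : Type*) [MeasurableSpace S] (P : Measure S) [IsProbabilityMeasure P]
        (X : Fin m → S → Ω) (_ : ∀ j, HasLaw (X j) μ P) (_ : iIndepFun X P),
        Integrable (fun s => samplingError μ W p (fun j => X j s)) P ∧
        discretizationNumber μ W p m ≤ ∫ s, samplingError μ W p (fun j => X j s) ∂P ∧
        ∫ s, samplingError μ W p (fun j => X j s) ∂P ≤
          C * p ^ 2 * M ^ max (p / 2) (p - 1) * (m : ℝ) ^ (-(1 / 2) : ℝ) *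
            chainEntropySum W p m ∧
        ∫ s, samplingError μ W p (fun j => X j s) ∂P ≤
          C * p ^ 2 * M ^ max (p / 2) (p - 1) * (m : ℝ) ^ (-(1 / 2) : ℝ) *
            entropySum W p m ∧
        chainEntropySum W p m ≤ C * entropySum W p m ∧
        entropySum W p m ≤ C * chainEntropySum W p m := by
  -- Chaining gives 10, and passing to `entropySum` costs a factor 4.
  refine ⟨40, by norm_num, ?_⟩
  intro 𝕜 _ Ω _ _ _ _ _ μ _ p hp M W hW hW0 m hm S _ P _ X hX hindep
  have hM : 0 ≤ M := (norm_nonneg _).trans (hW 0 hW0)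
  have hdist : ∀ f ∈ W, dist f 0 ≤ M := fun f hf => by simpa using hW f hf
  have h1 := integral_samplingError_le_chainEntropySum hp hm hW hW0 hX hindep
  have h2 := chainEntropySum_le_entropySum hW0 hdist hp hm
  have h3 := entropySum_le_chainEntropySum hW0 hdist hp m
  have hc0 : 0 ≤ chainEntropySum W p m := Finset.sum_nonneg fun k _ =>
    mul_nonneg (by positivity) (Real.rpow_nonneg (coveringRadius_nonneg _ _) _)
  have hs0 : 0 ≤ entropySum W p m := by linarith
  refine ⟨integrable_samplingError hp hm hW hW0 hX,
    discretizationNumber_le_integral hp hm hW hW0 hX, h1.trans (by gcongr; norm_num),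
    h1.trans ?_, by linarith, by linarith⟩
  calc _ ≤ 10 * p ^ 2 * M ^ max (p / 2) (p - 1) * (m : ℝ) ^ (-(1 / 2) : ℝ) *
        (4 * entropySum W p m) := by gcongr
    _ = _ := by ring
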